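/- Let $\mathrm{CAR}(\mathbb Z)$ be the universal unital $C^*$-algebra generated by elements $A_j$, $j\in\mathbb Z$, with adjoints $A_j^\dagger=(A_j)^*$, subject to the relations $$A_j^\dagger A_k+A_kA_j^\dagger=\delta_{j,k}I,\qquad A_jA_k+A_kA_j=A_j^\dagger A_k^\dagger+A_k^\dagger A_j^\dagger=0\qquad(j,k\in\mathbb Z).$$ Let $\mathbb L_{\mathbb Z}$ be the monoid, under composition, of all strictly increasing maps $f:\mathbb Z\to\mathbb Z$, and let $\mathbb J_{\mathbb Z}\subset\mathbb L_{\mathbb Z}$ be the submonoid of those $f$ for which $\mathbb Z\setminus f(\mathbb Z)$ is finite. Every $f\in\mathbb L_{\mathbb Z}$ acts on $\mathrm{CAR}(\mathbb Z)$ by the unital $*$-endomorphism determined by $A_j\mapsto A_{f(j)}$, and the group $\mathbb Z$ acts by the shifts $A_j\mapsto A_{j+n}$, $n\in\mathbb Z$. A state is a positive linear functional with value $1$ at $I$. Let $\mathcal S_{\mathbb J_{\mathbb Z}}$ and $\mathcal S_{\mathbb Z}$ be the sets of states of $\mathrm{CAR}(\mathbb Z)$ that are invariant under the action of $\mathbb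 J_{\mathbb Z}$ and under the shifts, respectively, and call a state spreadable if it is invariant under the action of $\mathbb L_{\mathbb Z}$. **Theorem.** The inclusion $$\mathcal S_{\mathbb J_{\mathbb Z}}\subsetneq\mathcal S_{\mathbb Z}$$ holds and is proper. Moreover, there are a constant $C>0$ and a state $\omega\in\mathcal S_{\mathbb Z}$ such that $$\omega(A_m^\dagger A_n)=i\,\frac{3C}{\pi^2(m-n)^2}\qquad\text{for all } m,n\in\mathbb Z \text{ with } m>n,$$ and $\omega\notin\mathcal S_{\mathbb J_{\mathbb Z}}$; in particular $\omega$ is not spreadable. -/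

import Mathlib

noncomputable section

/-- The canonical anticommutation relations for a family `a j`, `j ∈ ℤ`, in a unital `*`-ring.
The relation for two creators `star (a j)`, `star (a k)` is the adjoint of `anticomm`. -/
structure IsCAR {B : Type*} [Ring B] [StarRing B] (a : ℤ → B) : Prop where
  star_anticomm : ∀ j k, star (a j) * a k + a k * star (a j) = if j = k then 1 else 0
  anticomm : ∀ j k, a j * a k + a k * a j = 0

/-- The free unital complex `*`-algebra on generators `a j`, `j ∈ ℤ`: noncommutative complex
polynomials in the letters `(j, false)` (for `a j`) and `(j, true)` (for its adjoint). It is a copy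
of `FreeAlgebra` because the star that Mathlib puts on `FreeAlgebra` is the linear one which fixes
every letter, while here star is conjugate linear and exchanges `(j, false)` with `(j, true)`. -/
def CARPoly : Type := FreeAlgebra ℂ (ℤ × Bool)

namespace CARPoly

instance : Ring CARPoly := inferInstanceAs (Ring (FreeAlgebra ℂ (ℤ × Bool)))

instance : Algebra ℂ CARPoly := inferInstanceAs (Algebra ℂ (FreeAlgebra ℂ (ℤ × Bool)))

/-- The letter `x`. -/
def letter (x : ℤ × Bool) : CARPoly := FreeAlgebra.ι ℂ x

/-- The generator `a j`. -/
def gen (j : ℤ) : CARPoly := letter (j, false)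

/-- Adjoint of a letter. -/
def flip (x : ℤ × Bool) : ℤ × Bool := (x.1, !x.2)

theorem induction {P : CARPoly → Prop} (hc : ∀ c : ℂ, P (algebraMap ℂ CARPoly c))
    (hl : ∀ x, P (letter x)) (hm : ∀ p q, P p → P q → P (p * q))
    (ha : ∀ p q, P p → P q → P (p + q)) (p : CARPoly) : P p :=
  FreeAlgebra.induction ℂ (ℤ × Bool) (motive := P) hc hl hm ha p

/-- The scalars acting on the opposite algebra through complex conjugation. -/
def conjAlgebraMap : ℂ →+* CARPolyᵐᵒᵖ :=
  (algebraMap ℂ CARPolyᵐᵒᵖ).comp (starRingEnd ℂ)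

/-- The conjugate linear antihomomorphism exchanging `(j, false)` and `(j, true)`. -/
def starAux : CARPoly →+* CARPolyᵐᵒᵖ :=
  letI : Algebra ℂ CARPolyᵐᵒᵖ := conjAlgebraMap.toAlgebra' fun c x => by
    simpa [conjAlgebraMap] using Algebra.commutes (starRingEnd ℂ c) x
  (FreeAlgebra.lift ℂ (fun x => MulOpposite.op (letter (flip x))) :
    FreeAlgebra ℂ (ℤ × Bool) →ₐ[ℂ] CARPolyᵐᵒᵖ).toRingHom

theorem starAux_letter (x : ℤ × Bool) : starAux (letter x) = MulOpposite.op (letter (flip x)) := by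
  let _ : Algebra ℂ CARPolyᵐᵒᵖ := conjAlgebraMap.toAlgebra' fun c x => by
    simpa [conjAlgebraMap] using Algebra.commutes (starRingEnd ℂ c) x
  exact FreeAlgebra.lift_ι_apply (R := ℂ) (A := CARPolyᵐᵒᵖ)
    (fun x => MulOpposite.op (letter (flip x))) x

theorem starAux_algebraMap (c : ℂ) :
    starAux (algebraMap ℂ CARPoly c) = MulOpposite.op (algebraMap ℂ CARPoly (starRingEnd ℂ c)) := by
  let _ : Algebra ℂ CARPolyᵐᵒᵖ := conjAlgebraMap.toAlgebra' fun c x => by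
    simpa [conjAlgebraMap] using Algebra.commutes (starRingEnd ℂ c) x
  exact (FreeAlgebra.lift ℂ (fun x => MulOpposite.op (letter (flip x))) :
    FreeAlgebra ℂ (ℤ × Bool) →ₐ[ℂ] CARPolyᵐᵒᵖ).commutes c

instance : Star CARPoly := ⟨fun p => (starAux p).unop⟩

theorem star_def (p : CARPoly) : star p = (starAux p).unop := rfl

theorem star_letter (x : ℤ × Bool) : star (letter x) = letter (flip x) := by
  rw [star_def, starAux_letter, MulOpposite.unop_op]

theorem star_algebraMap (c : ℂ) :
    star (algebraMap ℂ CARPoly c) = algebraMap ℂ CARPoly (starRingEnd ℂ c) := by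
  rw [star_def, starAux_algebraMap, MulOpposite.unop_op]

theorem star_mul_aux (p q : CARPoly) : star (p * q) = star q * star p := by
  simp [star_def]

theorem star_add_aux (p q : CARPoly) : star (p + q) = star p + star q := by
  simp [star_def]

instance : StarRing CARPoly where
  star_involutive p := by
    induction p using CARPoly.induction with
    | hc c => simp [star_algebraMap]
    | hl x => simp [star_letter, flip]
    | hm p q hp hq => rw [star_mul_aux, star_mul_aux, hp, hq]
    | ha p q hp hq => rw [star_add_aux, star_add_aux, hp, hq]
  star_mul := star_mul_aux
  star_add := star_add_aux

instance : StarModule ℂ CARPoly where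
  star_smul c p := by
    rw [Algebra.smul_def, star_mul, star_algebraMap, Algebra.smul_def, starRingEnd_apply,
      Algebra.commutes]

theorem star_gen (j : ℤ) : star (gen j) = letter (j, true) := by
  simp [gen, star_letter, flip]

section Eval

variable {B : Type*} [Ring B] [StarRing B] [Algebra ℂ B]

/-- Evaluation of noncommutative `*`-polynomials at a family `b` in a unital `*`-algebra, without
the compatibility with star. -/
def evalAux (b : ℤ → B) : CARPoly →ₐ[ℂ] B :=
  FreeAlgebra.lift ℂ fun x : ℤ × Bool => if x.2 then star (b x.1) else b x.1

theorem evalAux_letter (b : ℤ → B) (x : ℤ × Bool) :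
    evalAux b (letter x) = if x.2 then star (b x.1) else b x.1 :=
  FreeAlgebra.lift_ι_apply _ _

/-- Evaluation of noncommutative `*`-polynomials at a family `b` in a unital `*`-algebra. -/
def eval [StarModule ℂ B] (b : ℤ → B) : CARPoly →⋆ₐ[ℂ] B where
  __ := evalAux b
  map_star' p := by
    change evalAux b (star p) = star (evalAux b p)
    induction p using CARPoly.induction with
    | hc c =>
      rw [star_algebraMap, AlgHom.commutes, AlgHom.commutes, starRingEnd_apply,
        algebraMap_star_comm]
    | hl x =>
      rw [star_letter, evalAux_letter, evalAux_letter]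
      rcases x with ⟨j, _ | _⟩ <;> simp [flip]
    | hm p q hp hq => rw [star_mul, map_mul, hp, hq, map_mul, star_mul]
    | ha p q hp hq => rw [star_add, map_add, hp, hq, map_add, star_add]

@[simp]
theorem eval_gen [StarModule ℂ B] (b : ℤ → B) (j : ℤ) : eval b (gen j) = b j := by
  have h : eval b (gen j) = evalAux b (letter (j, false)) := rfl
  rw [h, evalAux_letter]
  simp

end Eval

end CARPoly

open CARPoly in
/-- A `C*`-seminorm on the free `*`-algebra that vanishes on the anticommutation relations. -/
structure CARSeminorm extends Seminorm ℂ CARPoly where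
  mul_le' : ∀ p q : CARPoly, toFun (p * q) ≤ toFun p * toFun q
  cstar' : ∀ p : CARPoly, toFun (star p * p) = toFun p ^ 2
  star_anticomm' : ∀ j k : ℤ,
    toFun (star (gen j) * gen k + gen k * star (gen j) - if j = k then 1 else 0) = 0
  anticomm' : ∀ j k : ℤ, toFun (gen j * gen k + gen k * gen j) = 0

namespace CARSeminorm

instance : CoeFun CARSeminorm fun _ => CARPoly → ℝ := ⟨fun s => s.toFun⟩

variable (s : CARSeminorm)

theorem map_mul_le (p q : CARPoly) : s (p * q) ≤ s p * s q := s.mul_le' p q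

theorem map_star_mul_self (p : CARPoly) : s (star p * p) = s p ^ 2 := s.cstar' p

theorem nonneg (p : CARPoly) : 0 ≤ s p := apply_nonneg s.toSeminorm p

theorem map_add_le (p q : CARPoly) : s (p + q) ≤ s p + s q := map_add_le_add s.toSeminorm p q

theorem map_neg (p : CARPoly) : s (-p) = s p := map_neg_eq_map s.toSeminorm p

theorem apply_zero : s 0 = 0 := map_zero s.toSeminorm

theorem map_smul (c : ℂ) (p : CARPoly) : s (c • p) = ‖c‖ * s p := map_smul_eq_mul s.toSeminorm c p

theorem congr {p q : CARPoly} (h : s (p - q) = 0) : s p = s q := by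
  have h1 := s.map_add_le (p - q) q
  have h2 := s.map_add_le (-(p - q)) p
  rw [s.map_neg] at h2
  simp only [sub_add_cancel, neg_sub] at h1 h2
  linarith

theorem le_one_of_sq {t : ℝ} (h : t ^ 2 = t) : t ≤ 1 := by nlinarith [sq_nonneg (t - 1)]

theorem map_one_le : s 1 ≤ 1 := by
  have := s.map_star_mul_self 1
  simp only [star_one, mul_one] at this
  exact le_one_of_sq this.symm

theorem map_star (p : CARPoly) : s (star p) = s p := by
  have key : ∀ q : CARPoly, s q ≤ s (star q) := fun q => by
    have h1 := s.map_star_mul_self q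
    have h2 := s.map_mul_le (star q) q
    rcases (s.nonneg q).eq_or_lt with h0 | h0
    · rw [← h0]; exact s.nonneg _
    · by_contra hlt
      push Not at hlt
      nlinarith
  refine le_antisymm ?_ (key p)
  simpa using key (star p)

theorem map_gen_le (j : ℤ) : s (CARPoly.gen j) ≤ 1 := by
  set a := CARPoly.gen j
  have hz : s (a * a) = 0 := by
    have h := s.anticomm' j j
    change s (a * a + a * a) = 0 at h
    rw [← two_smul ℂ (a * a), s.map_smul] at h
    simpa using h
  have hr : s (star a * a + a * star a - 1) = 0 := by
    simpa using s.star_anticomm' j j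
  have hmul : s (star a * (star a * a + a * star a - 1) * a) = 0 := by
    refine le_antisymm ?_ (s.nonneg _)
    calc _ ≤ s (star a * (star a * a + a * star a - 1)) * s a := s.map_mul_le _ _
      _ ≤ (s (star a) * s (star a * a + a * star a - 1)) * s a :=
        mul_le_mul_of_nonneg_right (s.map_mul_le _ _) (s.nonneg _)
      _ = 0 := by rw [hr]; ring
  have hsq : s (star (a * a) * (a * a)) = 0 := by rw [s.map_star_mul_self, hz]; ring
  have hidem : s (star (star a * a) * (star a * a) - star a * a) = 0 := by
    refine le_antisymm ?_ (s.nonneg _)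
    have e : star (star a * a) * (star a * a) - star a * a =
        star a * (star a * a + a * star a - 1) * a + -(star (a * a) * (a * a)) := by
      simp only [star_mul, star_star]; noncomm_ring
    rw [e]
    refine (s.map_add_le _ _).trans ?_
    rw [s.map_neg, hmul, hsq, add_zero]
  have h1 := s.congr hidem
  rw [s.map_star_mul_self] at h1
  have h2 := le_one_of_sq h1
  rw [s.map_star_mul_self] at h2
  nlinarith [s.nonneg a]

/-- The zero seminorm. -/
instance : Inhabited CARSeminorm :=
  ⟨{ (0 : Seminorm ℂ CARPoly) with
      mul_le' := fun p q => by
        change (0 : Seminorm ℂ CARPoly) _ ≤ (0 : Seminorm ℂ CARPoly) _ * (0 : Seminorm ℂ CARPoly) _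
        simp
      cstar' := fun p => by
        change (0 : Seminorm ℂ CARPoly) _ = (0 : Seminorm ℂ CARPoly) _ ^ 2
        simp
      star_anticomm' := fun j k => rfl
      anticomm' := fun j k => rfl }⟩

theorem exists_bound (p : CARPoly) : ∃ M : ℝ, ∀ s : CARSeminorm, s p ≤ M := by
  induction p using CARPoly.induction with
  | hc c =>
    refine ⟨‖c‖, fun s => ?_⟩
    rw [Algebra.algebraMap_eq_smul_one, s.map_smul]
    exact mul_le_of_le_one_right (norm_nonneg c) s.map_one_le
  | hl x =>
    refine ⟨1, fun s => ?_⟩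
    rcases x with ⟨j, _ | _⟩
    · exact s.map_gen_le j
    · rw [← CARPoly.star_gen, s.map_star]
      exact s.map_gen_le j
  | hm p q hp hq =>
    obtain ⟨M, hM⟩ := hp
    obtain ⟨N, hN⟩ := hq
    exact ⟨M * N, fun s => (s.map_mul_le p q).trans
      (mul_le_mul (hM s) (hN s) (s.nonneg q) ((s.nonneg p).trans (hM s)))⟩
  | ha p q hp hq =>
    obtain ⟨M, hM⟩ := hp
    obtain ⟨N, hN⟩ := hq
    exact ⟨M + N, fun s => (s.map_add_le p q).trans (add_le_add (hM s) (hN s))⟩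

theorem bddAbove (p : CARPoly) : BddAbove (Set.range fun s : CARSeminorm => s p) := by
  obtain ⟨M, hM⟩ := exists_bound p
  exact ⟨M, by rintro _ ⟨s, rfl⟩; exact hM s⟩

/-- The largest `C*`-seminorm on the free `*`-algebra that vanishes on the anticommutation
relations, as a function. -/
def univ (p : CARPoly) : ℝ := ⨆ s : CARSeminorm, s p

theorem le_univ (p : CARPoly) : s p ≤ univ p := le_ciSup (bddAbove p) s

theorem univ_le {p : CARPoly} {M : ℝ} (h : ∀ s : CARSeminorm, s p ≤ M) : univ p ≤ M := ciSup_le h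

theorem univ_nonneg (p : CARPoly) : 0 ≤ univ p :=
  ((default : CARSeminorm).nonneg p).trans (le_univ _ p)

theorem univ_zero : univ 0 = 0 :=
  le_antisymm (univ_le fun s => s.apply_zero.le) (univ_nonneg 0)

theorem univ_add_le (p q : CARPoly) : univ (p + q) ≤ univ p + univ q :=
  univ_le fun s => (s.map_add_le p q).trans (add_le_add (s.le_univ p) (s.le_univ q))

theorem univ_mul_le (p q : CARPoly) : univ (p * q) ≤ univ p * univ q :=
  univ_le fun s => (s.map_mul_le p q).trans
    (mul_le_mul (s.le_univ p) (s.le_univ q) (s.nonneg q) (univ_nonneg p))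

theorem univ_neg (p : CARPoly) : univ (-p) = univ p := by
  simp only [univ, map_neg]

theorem univ_star (p : CARPoly) : univ (star p) = univ p := by
  simp only [univ, map_star]

theorem univ_smul_le (c : ℂ) (p : CARPoly) : univ (c • p) ≤ ‖c‖ * univ p :=
  univ_le fun s => by
    rw [s.map_smul]
    exact mul_le_mul_of_nonneg_left (s.le_univ p) (norm_nonneg c)

theorem univ_star_mul_self (p : CARPoly) : univ p * univ p ≤ univ (star p * p) := by
  have h : univ p ≤ Real.sqrt (univ (star p * p)) := univ_le fun s => by
    apply Real.le_sqrt_of_sq_le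
    rw [← s.map_star_mul_self]
    exact s.le_univ _
  calc univ p * univ p ≤ Real.sqrt (univ (star p * p)) * Real.sqrt (univ (star p * p)) :=
        mul_self_le_mul_self (univ_nonneg p) h
    _ = _ := Real.mul_self_sqrt (univ_nonneg _)

/-- The largest `C*`-seminorm, as a ring seminorm. -/
def univSeminorm : RingSeminorm CARPoly where
  toFun := univ
  map_zero' := univ_zero
  add_le' := univ_add_le
  neg' := univ_neg
  mul_le' := univ_mul_le

end CARSeminorm

namespace CARPoly

instance : SeminormedRing CARPoly := CARSeminorm.univSeminorm.toSeminormedRing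

theorem norm_def (p : CARPoly) : ‖p‖ = CARSeminorm.univ p := rfl

instance : NormedAlgebra ℂ CARPoly where
  norm_smul_le := CARSeminorm.univ_smul_le

instance : NormedStarGroup CARPoly where
  norm_star_le p := (CARSeminorm.univ_star p).le

end CARPoly

/-- The CAR algebra over `ℤ`: the universal unital `C*`-algebra generated by a family satisfying
the canonical anticommutation relations. It is the separated completion of the free `*`-algebra for
the largest `C*`-seminorm which vanishes on the relations. -/
def CARAlgebra : Type := UniformSpace.Completion CARPoly

namespace CARAlgebra

open UniformSpace

instance : NormedRing CARAlgebra := inferInstanceAs (NormedRing (Completion CARPoly))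

instance : CompleteSpace CARAlgebra := inferInstanceAs (CompleteSpace (Completion CARPoly))

instance : Algebra ℂ CARAlgebra := inferInstanceAs (Algebra ℂ (Completion CARPoly))

instance : NormedAlgebra ℂ CARAlgebra where
  norm_smul_le := norm_smul_le (α := ℂ) (β := Completion CARPoly)

/-- The canonical map from the free `*`-algebra. -/
def ofPoly (p : CARPoly) : CARAlgebra := (p : Completion CARPoly)

theorem norm_ofPoly (p : CARPoly) : ‖ofPoly p‖ = ‖p‖ := Completion.norm_coe p

theorem continuous_ofPoly : Continuous ofPoly := Completion.continuous_coe _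

theorem denseRange_ofPoly : DenseRange ofPoly := Completion.denseRange_coe

theorem ofPoly_add (p q : CARPoly) : ofPoly (p + q) = ofPoly p + ofPoly q := Completion.coe_add p q

theorem ofPoly_sub (p q : CARPoly) : ofPoly (p - q) = ofPoly p - ofPoly q := Completion.coe_sub p q

theorem ofPoly_mul (p q : CARPoly) : ofPoly (p * q) = ofPoly p * ofPoly q := Completion.coe_mul p q

theorem ofPoly_one : ofPoly 1 = 1 := Completion.coe_one CARPoly

theorem ofPoly_zero : ofPoly 0 = 0 := Completion.coe_zero

theorem ofPoly_smul (c : ℂ) (p : CARPoly) : ofPoly (c • p) = c • ofPoly p := Completion.coe_smul c p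

theorem ofPoly_algebraMap (c : ℂ) : ofPoly (algebraMap ℂ CARPoly c) = algebraMap ℂ CARAlgebra c := by
  rw [Algebra.algebraMap_eq_smul_one, ofPoly_smul, ofPoly_one, Algebra.algebraMap_eq_smul_one]

instance : Star CARAlgebra :=
  ⟨fun x => Completion.map (star : CARPoly → CARPoly) (x : Completion CARPoly)⟩

theorem continuous_star' : Continuous (star : CARAlgebra → CARAlgebra) :=
  Completion.continuous_map

theorem star_ofPoly (p : CARPoly) : star (ofPoly p) = ofPoly (star p) :=
  Completion.map_coe (starₗᵢ (E := CARPoly) ℂ).isometry.uniformContinuous p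

theorem induction_on {P : CARAlgebra → Prop} (x : CARAlgebra) (hP : IsClosed {y | P y})
    (h : ∀ p, P (ofPoly p)) : P x :=
  Completion.induction_on (p := P) x hP h

theorem induction_on₂ {P : CARAlgebra → CARAlgebra → Prop} (x y : CARAlgebra)
    (hP : IsClosed {z : CARAlgebra × CARAlgebra | P z.1 z.2})
    (h : ∀ p q, P (ofPoly p) (ofPoly q)) : P x y :=
  Completion.induction_on₂ (p := P) x y hP h

instance : StarRing CARAlgebra where
  star_involutive x := by
    refine induction_on (P := fun x => star (star x) = x) x
      (isClosed_eq (continuous_star'.comp continuous_star') continuous_id)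
      fun p => ?_
    rw [star_ofPoly, star_ofPoly, star_star]
  star_mul x y := by
    refine induction_on₂ (P := fun x y => star (x * y) = star y * star x) x y
      (isClosed_eq (continuous_star'.comp continuous_mul)
      ((continuous_star'.comp continuous_snd).mul (continuous_star'.comp continuous_fst)))
      fun p q => ?_
    rw [← ofPoly_mul, star_ofPoly, star_ofPoly, star_ofPoly, star_mul, ofPoly_mul]
  star_add x y := by
    refine induction_on₂ (P := fun x y => star (x + y) = star x + star y) x y
      (isClosed_eq (continuous_star'.comp continuous_add)
      ((continuous_star'.comp continuous_fst).add (continuous_star'.comp continuous_snd)))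
      fun p q => ?_
    rw [← ofPoly_add, star_ofPoly, star_ofPoly, star_ofPoly, star_add, ofPoly_add]

instance : CStarAlgebra CARAlgebra where
  norm_mul_self_le x := by
    refine induction_on (P := fun x => ‖x‖ * ‖x‖ ≤ ‖star x * x‖) x (isClosed_le (continuous_norm.mul continuous_norm)
      (continuous_norm.comp (continuous_star'.mul continuous_id))) fun p => ?_
    rw [star_ofPoly, ← ofPoly_mul, norm_ofPoly, norm_ofPoly]
    exact CARSeminorm.univ_star_mul_self p
  star_smul c x := by
    refine induction_on (P := fun x => star (c • x) = star c • star x) x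
      (isClosed_eq (continuous_star'.comp (continuous_const_smul c))
      ((continuous_const_smul (star c)).comp continuous_star')) fun p => ?_
    rw [← ofPoly_smul, star_ofPoly, star_ofPoly, star_smul, ofPoly_smul]

/-- The annihilator `A j`; the creator is `star (A j)`. -/
def A (j : ℤ) : CARAlgebra := ofPoly (CARPoly.gen j)

theorem ofPoly_eq_zero {p : CARPoly} (h : ∀ s : CARSeminorm, s p = 0) : ofPoly p = 0 := by
  rw [← norm_eq_zero, norm_ofPoly, CARPoly.norm_def]
  exact le_antisymm (CARSeminorm.univ_le fun s => (h s).le) (CARSeminorm.univ_nonneg p)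

theorem isCAR_A : IsCAR A where
  star_anticomm j k := by
    have h := ofPoly_eq_zero fun s => s.star_anticomm' j k
    rw [ofPoly_sub, sub_eq_zero, ofPoly_add, ofPoly_mul, ofPoly_mul, ← star_ofPoly] at h
    refine h.trans ?_
    split_ifs
    · exact ofPoly_one
    · exact ofPoly_zero
  anticomm j k := by
    have h := ofPoly_eq_zero fun s => s.anticomm' j k
    rwa [ofPoly_add, ofPoly_mul, ofPoly_mul] at h

section Lift

variable {B : Type*} [CStarAlgebra B]

theorem norm_eval_le {b : ℤ → B} (hb : IsCAR b) (p : CARPoly) : ‖CARPoly.eval b p‖ ≤ ‖p‖ := by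
  let s : CARSeminorm :=
    { toFun := fun p => ‖CARPoly.eval b p‖
      map_zero' := by simp
      add_le' := fun p q => by simpa using norm_add_le (CARPoly.eval b p) (CARPoly.eval b q)
      neg' := fun p => by simp
      smul' := fun c p => by simp [norm_smul]
      mul_le' := fun p q => by simpa using norm_mul_le (CARPoly.eval b p) (CARPoly.eval b q)
      cstar' := fun p => by simp [map_star, CStarRing.norm_star_mul_self, sq]
      star_anticomm' := fun j k => by
        have h := hb.star_anticomm j k
        change ‖CARPoly.eval b _‖ = 0
        rw [norm_eq_zero, map_sub, sub_eq_zero, map_add, map_mul, map_mul, map_star,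
          CARPoly.eval_gen, CARPoly.eval_gen, h]
        split_ifs <;> simp
      anticomm' := fun j k => by
        have h := hb.anticomm j k
        change ‖CARPoly.eval b _‖ = 0
        rw [norm_eq_zero, map_add, map_mul, map_mul, CARPoly.eval_gen, CARPoly.eval_gen, h] }
  exact s.le_univ p

theorem continuous_eval {b : ℤ → B} (hb : IsCAR b) : Continuous (CARPoly.eval b) :=
  AddMonoidHomClass.continuous_of_bound (CARPoly.eval b) 1 fun p => by
    simpa using norm_eval_le hb p

/-- Extension of the evaluation homomorphism to the completion, as a ring homomorphism. -/
def liftAux {b : ℤ → B} (hb : IsCAR b) : CARAlgebra →+* B :=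
  Completion.extensionHom (CARPoly.eval b : CARPoly →+* B) (continuous_eval hb)

theorem continuous_liftAux {b : ℤ → B} (hb : IsCAR b) : Continuous (liftAux hb) :=
  Completion.continuous_extension

theorem liftAux_ofPoly {b : ℤ → B} (hb : IsCAR b) (p : CARPoly) :
    liftAux hb (ofPoly p) = CARPoly.eval b p :=
  Completion.extensionHom_coe (CARPoly.eval b : CARPoly →+* B) (continuous_eval hb) p

/-- Universal property, existence: a family in a unital `C*`-algebra that satisfies the canonical
anticommutation relations is the image of the annihilators under a unital `*`-homomorphism. -/
def lift (b : ℤ → B) (hb : IsCAR b) : CARAlgebra →⋆ₐ[ℂ] B where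
  __ := liftAux hb
  commutes' c := by
    change liftAux hb (algebraMap ℂ CARAlgebra c) = _
    rw [← ofPoly_algebraMap, liftAux_ofPoly, AlgHomClass.commutes]
  map_star' x := by
    change liftAux hb (star x) = star (liftAux hb x)
    refine induction_on (P := fun x => liftAux hb (star x) = star (liftAux hb x)) x
      (isClosed_eq ((continuous_liftAux hb).comp continuous_star')
      (continuous_star.comp (continuous_liftAux hb))) fun p => ?_
    rw [star_ofPoly, liftAux_ofPoly, liftAux_ofPoly, map_star]

@[simp]
theorem lift_A (b : ℤ → B) (hb : IsCAR b) (j : ℤ) : lift b hb (A j) = b j :=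
  (liftAux_ofPoly hb _).trans (CARPoly.eval_gen b j)

theorem continuous_hom (φ : CARAlgebra →⋆ₐ[ℂ] B) : Continuous φ :=
  AddMonoidHomClass.continuous_of_bound φ 1 fun x => by
    simpa using NonUnitalStarAlgHom.norm_apply_le φ x

/-- Universal property, uniqueness. -/
theorem hom_ext {φ ψ : CARAlgebra →⋆ₐ[ℂ] B} (h : ∀ j, φ (A j) = ψ (A j)) : φ = ψ := by
  ext x
  refine induction_on (P := fun x => φ x = ψ x) x
    (isClosed_eq (continuous_hom φ) (continuous_hom ψ)) fun p => ?_
  induction p using CARPoly.induction with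
  | hc c => rw [ofPoly_algebraMap, AlgHomClass.commutes, AlgHomClass.commutes]
  | hl x =>
    rcases x with ⟨j, _ | _⟩
    · exact h j
    · rw [← CARPoly.star_gen, ← star_ofPoly, map_star, map_star]
      exact congrArg star (h j)
  | hm p q hp hq => rw [ofPoly_mul, map_mul, map_mul, hp, hq]
  | ha p q hp hq => rw [ofPoly_add, map_add, map_add, hp, hq]

end Lift

end CARAlgebra

/-- A state of a unital `C*`-algebra: a positive normalized linear functional. -/
structure IsState {𝔄 : Type*} [CStarAlgebra 𝔄] (φ : 𝔄 →ₗ[ℂ] ℂ) : Prop where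
  nonneg : ∀ x, 0 ≤ (φ (star x * x)).re ∧ (φ (star x * x)).im = 0
  map_one : φ 1 = 1

/-- The states of a unital `C*`-algebra that are invariant under an action `Γ` of a monoid by unital
`*`-endomorphisms. -/
def invariantStates {𝔄 : Type*} [CStarAlgebra 𝔄] {M : Type*} [Monoid M]
    (Γ : M →* (𝔄 →⋆ₐ[ℂ] 𝔄)) : Set (𝔄 →ₗ[ℂ] ℂ) :=
  {φ | IsState φ ∧ ∀ g x, φ (Γ g x) = φ x}

/-- The monoid `𝕃_ℤ` of strictly increasing maps of `ℤ` into itself, under composition. -/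
def monoidLZ : Submonoid (Function.End ℤ) where
  carrier := {f | StrictMono (f : ℤ → ℤ)}
  one_mem' := strictMono_id
  mul_mem' hf hg := hf.comp hg

/-- The monoid `𝕁_ℤ` of strictly increasing maps of `ℤ` into itself with cofinite range. -/
def monoidJZ : Submonoid monoidLZ where
  carrier := {f | (Set.range (f.1 : ℤ → ℤ))ᶜ.Finite}
  one_mem' := by
    change (Set.range (id : ℤ → ℤ))ᶜ.Finite
    simp
  mul_mem' {f g} hf hg := by
    change (Set.range ((f.1 : ℤ → ℤ) ∘ (g.1 : ℤ → ℤ)))ᶜ.Finite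
    refine (Set.Finite.union hf (Set.Finite.image f.1 hg)).subset ?_
    intro x hx
    by_cases h : x ∈ Set.range (f.1 : ℤ → ℤ)
    · obtain ⟨y, rfl⟩ := h
      refine Or.inr ⟨y, ?_, rfl⟩
      rintro ⟨z, rfl⟩
      exact hx ⟨z, rfl⟩
    · exact Or.inl h

/-- The powers `τ ^ n : k ↦ k + n` of the one-step shift, as a representation of the group `ℤ`. -/
def shiftHom : Multiplicative ℤ →* monoidLZ where
  toFun n := ⟨fun k => k + n.toAdd, fun _ _ h => by simpa using h⟩
  map_one' := by
    apply Subtype.ext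
    funext k
    exact add_zero k
  map_mul' m n := by
    apply Subtype.ext
    funext k
    change k + (m.toAdd + n.toAdd) = (k + n.toAdd) + m.toAdd
    ring

namespace CARAlgebra

theorem isCAR_comp {f : ℤ → ℤ} (hf : Function.Injective f) : IsCAR fun j => A (f j) where
  star_anticomm j k := by
    rw [isCAR_A.star_anticomm]
    simp [hf.eq_iff]
  anticomm j k := isCAR_A.anticomm _ _

/-- The unital `*`-endomorphism `A j ↦ A (f j)`, for `f` strictly increasing. -/
def endo (f : monoidLZ) : CARAlgebra →⋆ₐ[ℂ] CARAlgebra :=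
  lift (fun j => A (f.1 j)) (isCAR_comp (StrictMono.injective f.2))

theorem endo_A (f : monoidLZ) (j : ℤ) : endo f (A j) = A (f.1 j) := lift_A _ _ j

/-- The action of `𝕃_ℤ` on the CAR algebra by the unital `*`-endomorphisms `A j ↦ A (f j)`. -/
def actionLZ : monoidLZ →* (CARAlgebra →⋆ₐ[ℂ] CARAlgebra) where
  toFun := endo
  map_one' := hom_ext fun j => endo_A _ j
  map_mul' f g := hom_ext fun j => by
    change endo (f * g) (A j) = endo f (endo g (A j))
    rw [endo_A, endo_A, endo_A]
    rfl

theorem actionLZ_A (f : monoidLZ) (j : ℤ) : actionLZ f (A j) = A (f.1 j) := endo_A f j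

/-- The action of `𝕁_ℤ` on the CAR algebra. -/
def actionJZ : monoidJZ →* (CARAlgebra →⋆ₐ[ℂ] CARAlgebra) := actionLZ.comp monoidJZ.subtype

/-- The action of the group `ℤ` on the CAR algebra by shifts, `A j ↦ A (j + n)`. -/
def actionShift : Multiplicative ℤ →* (CARAlgebra →⋆ₐ[ℂ] CARAlgebra) := actionLZ.comp shiftHom

end CARAlgebra

end

/-! The inclusion holds because a shift is a bijection of `ℤ`, so the shifts lie in `𝕁_ℤ`. For
strictness it suffices to find a shift-invariant state with `ω(A_m† A_n) = const / (m - n)^2`: a map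
in `𝕁_ℤ` can stretch the distance between two sites, but cannot change the value of an invariant
state.

The state is a mixture of simpler ones. For each `k ≥ 1`, treat even and odd sites as two species of
fermions and set `b_j = (A_{2j} - i A_{2(j+k)} + A†_{2j+1} + i A†_{2(j+k)+1}) / 2`. The off-diagonal
anticommutators of the two species cancel, so the `b_j` again satisfy the CAR (`isCAR_bogoliubov`).
Pulling the Fock vacuum back along `A_j ↦ b_j` gives a state whose two-point function vanishes off
the distances `0` and `k`, with value `i/4` at `m = n + k` (`pairState_star_A_mul_A`). It is shift
invariant because shifting `j` by `n` shifts the underlying sites by `2n`, and the vacuum is shift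
invariant (`pairState_actionShift`).

Averaging over `k` with weights `6 / (π k)^2`, which sum to one by `ζ(2) = π²/6`, yields `i · 3C /
(π (m - n))^2` with `C = 1/2` (`longRangeState_star_A_mul_A`). The map skipping the site `1` carries
the pair `1, 0` to `2, 0` and would divide this value by four (`longRangeState_skipOne`). -/

noncomputable section

open scoped ComplexConjugate

namespace FockSpace

/-! ### Weighted composition operators on `ℓ²`. -/

section WeightedComposition

variable {ι : Type*}

/-- The weighted composition operator `f ↦ w * (f ∘ e)` on `ℓ²(ι)`, for a weight bounded by one. -/
def weightedComp (w : ι → ℂ) (hw : ∀ S, ‖w S‖ ≤ 1) (e : ι ≃ ι) :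
    lp (fun _ : ι => ℂ) 2 →L[ℂ] lp (fun _ : ι => ℂ) 2 :=
  have hs : ∀ f : lp (fun _ : ι => ℂ) 2, Summable fun S => ‖f S‖ ^ (2 : ENNReal).toReal :=
    fun f => (lp.memℓp f).summable (by norm_num)
  have hle : ∀ (f : lp (fun _ : ι => ℂ) 2) S,
      ‖w S * f (e S)‖ ^ (2 : ENNReal).toReal ≤ ‖f (e S)‖ ^ (2 : ENNReal).toReal := fun f S => by
    refine Real.rpow_le_rpow (norm_nonneg _) ?_ (by norm_num)
    rw [norm_mul]
    exact mul_le_of_le_one_left (norm_nonneg _) (hw S)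
  have hm : ∀ f : lp (fun _ : ι => ℂ) 2,
      Summable fun S => ‖w S * f (e S)‖ ^ (2 : ENNReal).toReal := fun f =>
    Summable.of_nonneg_of_le (fun S => by positivity) (hle f) (e.summable_iff.mpr (hs f))
  LinearMap.mkContinuous
    { toFun := fun f => ⟨fun S => w S * f (e S), memℓp_gen (hm f)⟩
      map_add' := fun f g => by
        ext S
        exact mul_add _ _ _
      map_smul' := fun c f => by
        ext S
        simp [mul_left_comm] } 1 fun f => by
    rw [one_mul]
    refine lp.norm_le_of_tsum_le (by norm_num) (norm_nonneg f) ?_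
    rw [lp.norm_rpow_eq_tsum (by norm_num) f,
      ← e.tsum_eq fun S => ‖f S‖ ^ (2 : ENNReal).toReal]
    exact (hm f).tsum_le_tsum (hle f) (e.summable_iff.mpr (hs f))

theorem weightedComp_apply (w : ι → ℂ) (hw : ∀ S, ‖w S‖ ≤ 1) (e : ι ≃ ι)
    (f : lp (fun _ : ι => ℂ) 2) (S : ι) : weightedComp w hw e f S = w S * f (e S) := rfl

/-- Reindexing the inner product along `e` moves the weight and the composition to the other factor,
so the adjoint is a weighted composition along `e.symm`. -/
theorem star_weightedComp_apply (w : ι → ℂ) (hw : ∀ S, ‖w S‖ ≤ 1) (e : ι ≃ ι)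
    (f : lp (fun _ : ι => ℂ) 2) (S : ι) :
    star (weightedComp w hw e) f S = conj (w (e.symm S)) * f (e.symm S) := by
  have h : weightedComp (fun S => conj (w (e.symm S))) (fun S => by simpa using hw _) e.symm =
      star (weightedComp w hw e) := by
    rw [ContinuousLinearMap.star_eq_adjoint, ContinuousLinearMap.eq_adjoint_iff]
    intro f g
    rw [lp.inner_eq_tsum, lp.inner_eq_tsum,
      ← e.tsum_eq fun S => inner ℂ (weightedComp (fun S => conj (w (e.symm S))) _ e.symm f S) (g S)]
    refine tsum_congr fun S => ?_
    simp only [weightedComp_apply, Equiv.symm_apply_apply, RCLike.inner_apply, map_mul,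
      Complex.conj_conj]
    ring
  rw [← h, weightedComp_apply]

end WeightedComposition

/-! ### Jordan-Wigner construction of the Fock representation. -/

/-- Toggling the membership of `k` in a finite set. -/
def toggle (k : ℤ) : Finset ℤ ≃ Finset ℤ :=
  (show Function.Involutive fun S : Finset ℤ => if k ∈ S then S.erase k else insert k S from
    fun S => by by_cases h : k ∈ S <;> simp [h]).toPerm

theorem toggle_apply (k : ℤ) (S : Finset ℤ) :
    toggle k S = if k ∈ S then S.erase k else insert k S := rfl

theorem toggle_symm (k : ℤ) : (toggle k).symm = toggle k := rfl

theorem toggle_toggle (k : ℤ) (S : Finset ℤ) : toggle k (toggle k S) = S :=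
  (toggle k).symm_apply_apply S

theorem mem_toggle {j k : ℤ} (S : Finset ℤ) :
    j ∈ toggle k S ↔ if j = k then j ∉ S else j ∈ S := by
  rw [toggle_apply]
  split_ifs <;> simp_all

theorem toggle_comm (j k : ℤ) (S : Finset ℤ) : toggle j (toggle k S) = toggle k (toggle j S) := by
  ext i
  simp only [mem_toggle]
  split_ifs <;> rfl

/-- The Jordan-Wigner sign: the parity of the number of elements of `S` below `j`. -/
def sign (j : ℤ) (S : Finset ℤ) : ℂ := ∏ i ∈ S, if i < j then -1 else 1

/-- This sign is the source of all anticommutation: for `j ≠ k` exactly one of `k < j` and `j < k`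
holds, so exactly one of the two orders of toggling picks up a `-1`. -/
theorem sign_toggle (j k : ℤ) (S : Finset ℤ) :
    sign j (toggle k S) = (if k < j then -1 else 1) * sign j S := by
  rw [toggle_apply]
  split_ifs with h h' h'
  · rw [sign, sign, ← Finset.mul_prod_erase S _ h, if_pos h']; ring
  · rw [sign, sign, ← Finset.mul_prod_erase S _ h, if_neg h']; ring
  · rw [sign, sign, Finset.prod_insert h, if_pos h']
  · rw [sign, sign, Finset.prod_insert h, if_neg h']

theorem sign_eq_or (j : ℤ) (S : Finset ℤ) : sign j S = 1 ∨ sign j S = -1 :=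
  Finset.prod_induction _ (fun x : ℂ => x = 1 ∨ x = -1)
    (by rintro _ _ (rfl | rfl) (rfl | rfl) <;> simp) (by simp) fun i _ => by split_ifs <;> simp

theorem sign_mul_self (j : ℤ) (S : Finset ℤ) : sign j S * sign j S = 1 := by
  rcases sign_eq_or j S with h | h <;> simp [h]

theorem conj_sign (j : ℤ) (S : Finset ℤ) : conj (sign j S) = sign j S := by
  rcases sign_eq_or j S with h | h <;> simp [h]

/-- The annihilation operator of the Fock representation on `ℓ²` of the finite subsets of `ℤ`. -/
def annihilator (j : ℤ) :
    lp (fun _ : Finset ℤ => ℂ) 2 →L[ℂ] lp (fun _ : Finset ℤ => ℂ) 2 :=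
  weightedComp (fun S => if j ∈ S then 0 else sign j S)
    (fun S => by rcases sign_eq_or j S with h | h <;> split_ifs <;> simp [h]) (toggle j)

theorem annihilator_apply (j : ℤ) (f : lp (fun _ : Finset ℤ => ℂ) 2) (S : Finset ℤ) :
    annihilator j f S = (if j ∈ S then 0 else sign j S) * f (toggle j S) := rfl

theorem star_annihilator_apply (j : ℤ) (f : lp (fun _ : Finset ℤ => ℂ) 2) (S : Finset ℤ) :
    star (annihilator j) f S = (if j ∈ S then sign j S else 0) * f (toggle j S) := by
  rw [annihilator, star_weightedComp_apply, toggle_symm, sign_toggle]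
  by_cases h : j ∈ S <;> simp [h, mem_toggle, conj_sign]

/-- For `j = k`, `a† a` and `a a†` are the projections onto the functions supported on `j ∈ S` and
on `j ∉ S`, and `a a = 0`. For `j ≠ k` both products toggle the same two sites, with opposite signs
by `sign_toggle`. -/
theorem isCAR_annihilator : IsCAR annihilator where
  star_anticomm j k := by
    ext f S
    change star (annihilator j) (annihilator k f) S +
      annihilator k (star (annihilator j) f) S = _
    rw [star_annihilator_apply, annihilator_apply, annihilator_apply, star_annihilator_apply]
    rcases eq_or_ne j k with rfl | hjk
    · rw [toggle_toggle, sign_toggle]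
      have := sign_mul_self j S
      by_cases h : j ∈ S <;> simp [h, mem_toggle, ← mul_assoc, this]
    · rw [if_neg hjk, sign_toggle, sign_toggle, toggle_comm k j]
      rcases hjk.lt_or_gt with h | h <;> by_cases hj : j ∈ S <;> by_cases hk : k ∈ S <;>
        simp [h, h.not_gt, h.ne, h.ne', hj, hk, mem_toggle] <;> ring
  anticomm j k := by
    ext f S
    change annihilator j (annihilator k f) S + annihilator k (annihilator j f) S = 0
    rw [annihilator_apply, annihilator_apply, annihilator_apply, annihilator_apply]
    rcases eq_or_ne j k with rfl | hjk
    · by_cases h : j ∈ S <;> simp [h, mem_toggle]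
    · rw [sign_toggle, sign_toggle, toggle_comm k j]
      rcases hjk.lt_or_gt with h | h <;> by_cases hj : j ∈ S <;> by_cases hk : k ∈ S <;>
        simp [h, h.not_gt, h.ne, h.ne', hj, hk, mem_toggle] <;> ring

/-! ### Unitary implementation of the shifts, and the vacuum vector. -/

/-- Translation by `n` on finite subsets of `ℤ`. -/
def translate (n : ℤ) : Finset ℤ ≃ Finset ℤ := (Equiv.addRight n).finsetCongr

theorem mem_translate (n j : ℤ) (S : Finset ℤ) : j ∈ translate n S ↔ j - n ∈ S := by
  simp [translate, Equiv.finsetCongr, sub_eq_add_neg]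

theorem translate_toggle (n j : ℤ) (S : Finset ℤ) :
    translate n (toggle j S) = toggle (j + n) (translate n S) := by
  ext i
  simp only [mem_translate, mem_toggle, sub_eq_iff_eq_add]

theorem sign_translate (n j : ℤ) (S : Finset ℤ) : sign (j + n) (translate n S) = sign j S := by
  simp [sign, translate, Equiv.finsetCongr]

/-- The unitary on Fock space which implements the translation `k ↦ k + n`. -/
def shiftOp (n : ℤ) : lp (fun _ : Finset ℤ => ℂ) 2 →L[ℂ] lp (fun _ : Finset ℤ => ℂ) 2 :=
  weightedComp (fun _ => 1) (fun _ => by simp) (translate n)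

theorem shiftOp_apply (n : ℤ) (f : lp (fun _ : Finset ℤ => ℂ) 2) (S : Finset ℤ) :
    shiftOp n f S = f (translate n S) := by
  rw [shiftOp, weightedComp_apply, one_mul]

theorem star_shiftOp_apply (n : ℤ) (f : lp (fun _ : Finset ℤ => ℂ) 2) (S : Finset ℤ) :
    star (shiftOp n) f S = f ((translate n).symm S) := by
  rw [shiftOp, star_weightedComp_apply]
  simp

theorem star_shiftOp_mul_self (n : ℤ) : star (shiftOp n) * shiftOp n = 1 := by
  ext f S
  change star (shiftOp n) (shiftOp n f) S = f S
  rw [star_shiftOp_apply, shiftOp_apply, Equiv.apply_symm_apply]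

theorem shiftOp_mul_star_self (n : ℤ) : shiftOp n * star (shiftOp n) = 1 := by
  ext f S
  change shiftOp n (star (shiftOp n) f) S = f S
  rw [shiftOp_apply, star_shiftOp_apply, Equiv.symm_apply_apply]

theorem shiftOp_conj_annihilator (n j : ℤ) :
    shiftOp n * annihilator (j + n) * star (shiftOp n) = annihilator j := by
  ext f S
  change shiftOp n (annihilator (j + n) (star (shiftOp n) f)) S = _
  rw [shiftOp_apply, annihilator_apply, star_shiftOp_apply, annihilator_apply, sign_translate,
    ← translate_toggle, Equiv.symm_apply_apply]
  simp only [mem_translate, add_sub_cancel_right]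

/-- The vacuum vector. -/
def vacuum : lp (fun _ : Finset ℤ => ℂ) 2 := lp.single 2 ∅ 1

theorem norm_vacuum : ‖vacuum‖ = 1 := by
  rw [vacuum, lp.norm_single (by norm_num)]
  simp

theorem vacuum_apply (S : Finset ℤ) : vacuum S = if S = ∅ then 1 else 0 := by
  rw [vacuum, lp.single_apply]
  by_cases h : S = ∅ <;> simp [h]

theorem annihilator_vacuum (j : ℤ) : annihilator j vacuum = 0 := by
  ext S
  rw [annihilator_apply, vacuum_apply]
  by_cases h : j ∈ S
  · simp [h]
  · simp [h, toggle_apply]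

theorem star_shiftOp_vacuum (n : ℤ) : star (shiftOp n) vacuum = vacuum := by
  ext S
  rw [star_shiftOp_apply, vacuum_apply, vacuum_apply]
  congr 1
  rw [Equiv.symm_apply_eq, eq_iff_iff]
  simp [translate, Equiv.finsetCongr]

end FockSpace

/-! ### The vacuum state and its two-point function. -/

namespace CARAlgebra

open FockSpace

/-- The Fock representation. -/
def fockRep : CARAlgebra →⋆ₐ[ℂ]
    (lp (fun _ : Finset ℤ => ℂ) 2 →L[ℂ] lp (fun _ : Finset ℤ => ℂ) 2) :=
  lift annihilator isCAR_annihilator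

theorem fockRep_A (j : ℤ) : fockRep (A j) = annihilator j := lift_A _ _ j

/-- Both sides are `*`-homomorphisms in `x`, so it is enough to compare them on the generators. -/
theorem fockRep_actionShift (n : Multiplicative ℤ) (x : CARAlgebra) :
    shiftOp n.toAdd * fockRep (actionShift n x) * star (shiftOp n.toAdd) = fockRep x := by
  have h1 := shiftOp_mul_star_self n.toAdd
  have h2 := star_shiftOp_mul_self n.toAdd
  let u : unitary (lp (fun _ : Finset ℤ => ℂ) 2 →L[ℂ] lp (fun _ : Finset ℤ => ℂ) 2) :=
    ⟨shiftOp n.toAdd, h2, h1⟩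
  have h : ((Unitary.conjStarAlgAut ℂ _ u : _ →⋆ₐ[ℂ] _).comp fockRep).comp (actionShift n) =
      fockRep := hom_ext fun j => by
    change shiftOp n.toAdd * fockRep (actionLZ (shiftHom n) (A j)) * star (shiftOp n.toAdd) = _
    rw [actionLZ_A, fockRep_A]
    exact (shiftOp_conj_annihilator n.toAdd j).trans (fockRep_A j).symm
  exact DFunLike.congr_fun h x

/-- The vacuum state. -/
def vacuumState : CARAlgebra →ₗ[ℂ] ℂ where
  toFun x := inner ℂ vacuum (fockRep x vacuum)
  map_add' x y := by rw [map_add, add_apply, inner_add_right]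
  map_smul' c x := by
    rw [map_smul, smul_apply, inner_smul_right, RingHom.id_apply, smul_eq_mul]

theorem vacuumState_apply (x : CARAlgebra) :
    vacuumState x = inner ℂ vacuum (fockRep x vacuum) := rfl

theorem vacuumState_star_mul (x y : CARAlgebra) :
    vacuumState (star x * y) = inner ℂ (fockRep x vacuum) (fockRep y vacuum) := by
  rw [vacuumState_apply, map_mul, map_star, ContinuousLinearMap.star_eq_adjoint,
    mul_apply_eq_comp, ContinuousLinearMap.adjoint_inner_right]

theorem isState_vacuumState : IsState vacuumState where
  nonneg x := by
    rw [vacuumState_star_mul, inner_self_eq_norm_sq_to_K]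
    norm_cast
    exact ⟨sq_nonneg ‖fockRep x vacuum‖, rfl⟩
  map_one := by
    rw [vacuumState_apply, map_one, one_apply_eq_self, inner_self_eq_norm_sq_to_K,
      norm_vacuum]
    simp

/-- Needed for the infinite mixture below to converge at every element of the algebra. -/
theorem norm_vacuumState_le (x : CARAlgebra) : ‖vacuumState x‖ ≤ ‖x‖ := by
  calc ‖vacuumState x‖ ≤ ‖vacuum‖ * ‖fockRep x vacuum‖ := by
        rw [vacuumState_apply]
        exact norm_inner_le_norm _ _
    _ ≤ ‖vacuum‖ * (‖fockRep x‖ * ‖vacuum‖) := by gcongr; exact (fockRep x).le_opNorm _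
    _ = ‖fockRep x‖ := by rw [norm_vacuum, one_mul, mul_one]
    _ ≤ ‖x‖ := NonUnitalStarAlgHom.norm_apply_le fockRep x

/-- The unitary that implements the shift fixes the vacuum vector. -/
theorem vacuumState_actionShift (n : Multiplicative ℤ) (x : CARAlgebra) :
    vacuumState (actionShift n x) = vacuumState x := by
  have h := star_shiftOp_vacuum n.toAdd
  rw [vacuumState_apply x, ← fockRep_actionShift n x, mul_apply_eq_comp,
    mul_apply_eq_comp, h, ← ContinuousLinearMap.adjoint_inner_left,
    ← ContinuousLinearMap.star_eq_adjoint, h, vacuumState_apply]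

theorem vacuumState_mul_A (x : CARAlgebra) (j : ℤ) : vacuumState (x * A j) = 0 := by
  rw [vacuumState_apply, map_mul, fockRep_A, mul_apply_eq_comp,
    annihilator_vacuum, map_zero, inner_zero_right]

theorem vacuumState_star_A_mul (x : CARAlgebra) (j : ℤ) : vacuumState (star (A j) * x) = 0 := by
  rw [vacuumState_star_mul, fockRep_A, annihilator_vacuum, inner_zero_left]

/-- The vacuum kills `A_k† A_j`, so only the scalar anticommutator is left. -/
theorem vacuumState_A_mul_star_A (j k : ℤ) :
    vacuumState (A j * star (A k)) = if j = k then 1 else 0 := by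
  have h := congrArg vacuumState (isCAR_A.star_anticomm k j)
  rw [map_add, vacuumState_mul_A, zero_add] at h
  rw [h]
  simp only [eq_comm (a := k)]
  split_ifs
  · exact isState_vacuumState.map_one
  · exact map_zero _

/-! ### Bogoliubov transforms correlating two sites. -/

/-- A translation-covariant Bogoliubov transform of the annihilators, which correlates the sites
`j` and `j + k` in the vacuum state. -/
def bogoliubov (k j : ℤ) : CARAlgebra :=
  (1 / 2 : ℂ) • (A (2 * j) - Complex.I • A (2 * (j + k)) +
    (star (A (2 * j + 1)) + Complex.I • star (A (2 * (j + k) + 1))))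

theorem star_bogoliubov (k j : ℤ) : star (bogoliubov k j) =
    (1 / 2 : ℂ) • (star (A (2 * j)) + Complex.I • star (A (2 * (j + k))) +
      (A (2 * j + 1) - Complex.I • A (2 * (j + k) + 1))) := by
  simp only [bogoliubov, star_smul, star_add, star_sub, star_star]
  simp [sub_eq_add_neg]

theorem star_A_mul_star_A_add (j k : ℤ) : star (A j) * star (A k) + star (A k) * star (A j) = 0 := by
  simpa using congrArg star (isCAR_A.anticomm k j)

theorem A_mul_star_A_add (j k : ℤ) :
    A j * star (A k) + star (A k) * A j = if j = k then 1 else 0 := by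
  rw [add_comm, isCAR_A.star_anticomm]
  simp only [eq_comm]

/-- The anticommutator as a bilinear map. -/
def antiComm : CARAlgebra →ₗ[ℂ] CARAlgebra →ₗ[ℂ] CARAlgebra :=
  LinearMap.mul ℂ CARAlgebra + (LinearMap.mul ℂ CARAlgebra).flip

theorem antiComm_apply (x y : CARAlgebra) : antiComm x y = x * y + y * x := rfl

theorem antiComm_A_A (j k : ℤ) : antiComm (A j) (A k) = 0 := isCAR_A.anticomm j k

theorem antiComm_star_A_star_A (j k : ℤ) : antiComm (star (A j)) (star (A k)) = 0 :=
  star_A_mul_star_A_add j k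

theorem antiComm_star_A_A (j k : ℤ) : antiComm (star (A j)) (A k) = if j = k then 1 else 0 :=
  isCAR_A.star_anticomm j k

theorem antiComm_A_star_A (j k : ℤ) : antiComm (A j) (star (A k)) = if j = k then 1 else 0 :=
  A_mul_star_A_add j k

theorem isCAR_bogoliubov (k : ℤ) : IsCAR (bogoliubov k) where
  star_anticomm j l := by
    have e0 : ∀ a b : ℤ, 2 * a = 2 * b ↔ a = b := fun a b => by lia
    rw [← antiComm_apply, star_bogoliubov, bogoliubov]
    simp only [map_smul, map_add, map_sub, LinearMap.smul_apply, LinearMap.add_apply,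
      LinearMap.sub_apply, antiComm_A_A, antiComm_A_star_A, antiComm_star_A_A,
      antiComm_star_A_star_A, add_left_inj, e0]
    -- The even and the odd sites each contribute `1/2` to the coefficient of `j = l`; their terms
    -- at `j + k = l` and `j = l + k` carry `±i/4` with opposite signs and cancel.
    match_scalars <;> ring_nf
    rw [Complex.I_sq]
    norm_num
  anticomm j l := by
    rw [← antiComm_apply, bogoliubov, bogoliubov]
    -- Annihilators enter only at even sites and creators only at odd ones, so no annihilator meets
    -- its own adjoint.
    have e1 : ∀ a b : ℤ, 2 * a + 1 = 2 * b ↔ False := fun a b => by lia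
    have e2 : ∀ a b : ℤ, 2 * a = 2 * b + 1 ↔ False := fun a b => by lia
    simp only [map_smul, map_add, map_sub, LinearMap.smul_apply, LinearMap.add_apply,
      LinearMap.sub_apply, antiComm_A_A, antiComm_A_star_A, antiComm_star_A_A,
      antiComm_star_A_star_A, e1, e2, if_false, smul_zero, add_zero, sub_zero]

end CARAlgebra

/-! ### Shift-invariant states correlating only sites at distance `k`. -/

namespace CARAlgebra

/-- The shift-invariant state whose two-point function is supported on distances `0` and `k`. -/
def pairState (k : ℤ) : CARAlgebra →ₗ[ℂ] ℂ :=
  vacuumState ∘ₗ (lift (bogoliubov k) (isCAR_bogoliubov k)).toLinearMap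

theorem pairState_apply (k : ℤ) (x : CARAlgebra) :
    pairState k x = vacuumState (lift (bogoliubov k) (isCAR_bogoliubov k) x) := rfl

theorem isState_pairState (k : ℤ) : IsState (pairState k) where
  nonneg x := by
    rw [pairState_apply, map_mul, map_star]
    exact isState_vacuumState.nonneg _
  map_one := by rw [pairState_apply, map_one, isState_vacuumState.map_one]

theorem norm_pairState_le (k : ℤ) (x : CARAlgebra) : ‖pairState k x‖ ≤ ‖x‖ :=
  (norm_vacuumState_le _).trans
    (NonUnitalStarAlgHom.norm_apply_le (lift (bogoliubov k) (isCAR_bogoliubov k)) x)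

theorem actionShift_A (n : Multiplicative ℤ) (j : ℤ) : actionShift n (A j) = A (j + n.toAdd) :=
  actionLZ_A (shiftHom n) j

/-- The group is written multiplicatively: `n * n` is the shift by twice `n`, since the index `j`
occupies the sites `2j` and `2j + 1`. -/
theorem lift_bogoliubov_actionShift (k : ℤ) (n : Multiplicative ℤ) (x : CARAlgebra) :
    lift (bogoliubov k) (isCAR_bogoliubov k) (actionShift n x) =
      actionShift (n * n) (lift (bogoliubov k) (isCAR_bogoliubov k) x) := by
  have h : (lift (bogoliubov k) (isCAR_bogoliubov k)).comp (actionShift n) =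
      (actionShift (n * n)).comp (lift (bogoliubov k) (isCAR_bogoliubov k)) := hom_ext fun j => by
    rw [StarAlgHom.comp_apply, StarAlgHom.comp_apply, actionShift_A, lift_A, lift_A, bogoliubov,
      bogoliubov]
    simp only [map_smul, map_add, map_sub, map_star, actionShift_A, toAdd_mul]
    ring_nf
  exact DFunLike.congr_fun h x

theorem pairState_actionShift (k : ℤ) (n : Multiplicative ℤ) (x : CARAlgebra) :
    pairState k (actionShift n x) = pairState k x := by
  rw [pairState_apply, lift_bogoliubov_actionShift, vacuumState_actionShift, pairState_apply]

/-- Only the odd sites contribute, through `⟨A A†⟩`; every other product has an annihilator on the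
right or a creator on the left. -/
theorem pairState_star_A_mul_A (k m n : ℤ) : pairState k (star (A m) * A n) =
    (1 / 2 : ℂ) * (if m = n then 1 else 0) + Complex.I / 4 * (if m = n + k then 1 else 0) -
      Complex.I / 4 * (if m + k = n then 1 else 0) := by
  have e0 : ∀ a b : ℤ, 2 * a = 2 * b ↔ a = b := fun a b => by lia
  have e1 : 2 * m + 2 * k = 2 * n ↔ m + k = n := by lia
  have e2 : 2 * m = 2 * n + 2 * k ↔ m = n + k := by lia
  rw [pairState_apply, map_mul, map_star, lift_A, lift_A, star_bogoliubov, bogoliubov]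
  simp only [mul_add, add_mul, mul_sub, sub_mul, smul_mul_assoc, mul_smul_comm, map_add, map_sub,
    map_smul, vacuumState_mul_A, vacuumState_star_A_mul, vacuumState_A_mul_star_A, add_left_inj,
    e0, e1, e2, smul_eq_mul]
  ring_nf
  rw [Complex.I_sq]
  ring_nf

end CARAlgebra

/-! ### Countable mixtures of states. -/

section Mixture

variable {𝔄 : Type*} [CStarAlgebra 𝔄] {w : ℕ → ℝ} {φ : ℕ → 𝔄 →ₗ[ℂ] ℂ}

theorem summable_mixture (hw : ∀ k, 0 ≤ w k) (hs : Summable w)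
    (hφ : ∀ k x, ‖φ k x‖ ≤ ‖x‖) (x : 𝔄) : Summable fun k => (w k : ℂ) * φ k x :=
  Summable.of_norm_bounded (hs.mul_right ‖x‖) fun k => by
    rw [norm_mul, Complex.norm_real, Real.norm_of_nonneg (hw k)]
    exact mul_le_mul_of_nonneg_left (hφ k x) (hw k)

/-- A countable convex combination of contractive functionals. -/
def mixture (hw : ∀ k, 0 ≤ w k) (hs : Summable w) (hφ : ∀ k x, ‖φ k x‖ ≤ ‖x‖) : 𝔄 →ₗ[ℂ] ℂ where
  toFun x := ∑' k, (w k : ℂ) * φ k x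
  map_add' x y := by
    rw [← (summable_mixture hw hs hφ x).tsum_add (summable_mixture hw hs hφ y)]
    simp [mul_add]
  map_smul' c x := by
    rw [RingHom.id_apply, smul_eq_mul, ← tsum_mul_left]
    simp [mul_left_comm]

theorem mixture_apply (hw : ∀ k, 0 ≤ w k) (hs : Summable w) (hφ : ∀ k x, ‖φ k x‖ ≤ ‖x‖) (x : 𝔄) :
    mixture hw hs hφ x = ∑' k, (w k : ℂ) * φ k x := rfl

theorem isState_mixture (hw : ∀ k, 0 ≤ w k) (hs : Summable w) (hφ : ∀ k x, ‖φ k x‖ ≤ ‖x‖)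
    (h1 : ∑' k, w k = 1) (h : ∀ k, IsState (φ k)) : IsState (mixture hw hs hφ) where
  nonneg x := by
    have hsum := summable_mixture hw hs hφ (star x * x)
    rw [mixture_apply, Complex.re_tsum hsum, Complex.im_tsum hsum]
    constructor
    · refine tsum_nonneg fun k => ?_
      rw [Complex.re_ofReal_mul]
      exact mul_nonneg (hw k) ((h k).nonneg x).1
    · simp [((h _).nonneg x).2]
  map_one := by
    simp only [mixture_apply, (h _).map_one, mul_one]
    rw [← Complex.ofReal_tsum, h1, Complex.ofReal_one]

end Mixture

theorem hasSum_six_div_pi_sq_mul_sq :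
    HasSum (fun k : ℕ => 6 / (Real.pi ^ 2 * ((k : ℝ) + 1) ^ 2)) 1 := by
  have h := ((hasSum_nat_add_iff' 1).mpr hasSum_zeta_two).mul_left (6 / Real.pi ^ 2)
  have hpi := Real.pi_ne_zero
  -- The removed term of the zeta series is `1 / 0 ^ 2`, which is `0` by convention, so the sum
  -- stays `π² / 6`.
  have h1 : 6 / Real.pi ^ 2 * (Real.pi ^ 2 / 6 - ∑ i ∈ Finset.range 1, 1 / (i : ℝ) ^ 2) = 1 := by
    simp
  rw [h1] at h
  refine h.congr_fun fun k => ?_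
  push_cast
  field_simp

/-! ### The state with inverse-square correlations. -/

namespace CARAlgebra

/-- The convex combination of the states `pairState (k + 1)` with weights `6 / (π (k + 1)) ^ 2`. -/
def longRangeState : CARAlgebra →ₗ[ℂ] ℂ :=
  mixture (fun k => by positivity) hasSum_six_div_pi_sq_mul_sq.summable
    fun k x => norm_pairState_le ((k : ℤ) + 1) x

theorem longRangeState_apply (x : CARAlgebra) : longRangeState x =
    ∑' k : ℕ, ((6 / (Real.pi ^ 2 * ((k : ℝ) + 1) ^ 2) : ℝ) : ℂ) * pairState ((k : ℤ) + 1) x := rfl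

theorem longRangeState_mem : longRangeState ∈ invariantStates actionShift :=
  ⟨isState_mixture _ _ _ hasSum_six_div_pi_sq_mul_sq.tsum_eq fun k => isState_pairState _,
    fun n x => by simp only [longRangeState_apply, pairState_actionShift]⟩

theorem longRangeState_star_A_mul_A {m n : ℤ} (h : n < m) : longRangeState (star (A m) * A n) =
    3 * ((1 / 2 : ℝ) : ℂ) * Complex.I / ((Real.pi : ℂ) ^ 2 * ((m : ℂ) - (n : ℂ)) ^ 2) := by
  -- The mixture is indexed from `0` while distances start at `1`, so the only contributing index is
  -- `d = m - n - 1`. Its term is `(i/4) · 6 / (π (d + 1))^2`, hence `3C = 3/2`.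
  obtain ⟨d, rfl⟩ : ∃ d : ℕ, m = n + ((d : ℤ) + 1) := ⟨(m - n - 1).toNat, by lia⟩
  rw [longRangeState_apply, tsum_eq_single d]
  · rw [pairState_star_A_mul_A, if_neg (by lia), if_pos rfl, if_neg (by lia)]
    have hpi : (Real.pi : ℂ) ≠ 0 := Complex.ofReal_ne_zero.mpr Real.pi_ne_zero
    have hd : (d : ℂ) + 1 ≠ 0 := Nat.cast_add_one_ne_zero d
    push_cast
    rw [add_sub_cancel_left]
    field_simp
    ring
  · intro k hk
    rw [pairState_star_A_mul_A, if_neg (by lia), if_neg (by lia), if_neg (by lia)]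
    simp

/-- The strictly increasing map with range `ℤ \ {1}` which fixes the non-positive integers. -/
def skipOne : monoidJZ :=
  ⟨⟨fun k => if k ≤ 0 then k else k + 1, fun a b h => by
    change (if a ≤ 0 then a else a + 1) < if b ≤ 0 then b else b + 1
    split_ifs <;> lia⟩, by
    refine (Set.finite_singleton (1 : ℤ)).subset fun x hx => ?_
    by_contra h1
    rw [Set.mem_singleton_iff] at h1
    refine hx (if h : x ≤ 0 then ⟨x, if_pos h⟩ else ⟨x - 1, ?_⟩)
    change (if x - 1 ≤ 0 then x - 1 else x - 1 + 1) = x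
    split_ifs <;> lia⟩

/-- Skipping the site `1` doubles the distance between the two sites, so the left value is a quarter
of the nonzero right one. -/
theorem longRangeState_skipOne :
    longRangeState (actionJZ skipOne (star (A 1) * A 0)) ≠ longRangeState (star (A 1) * A 0) := by
  have h1 : actionJZ skipOne (A 1) = A 2 := actionLZ_A skipOne.1 1
  have h0 : actionJZ skipOne (A 0) = A 0 := actionLZ_A skipOne.1 0
  rw [map_mul, map_star, h1, h0, longRangeState_star_A_mul_A (by norm_num),
    longRangeState_star_A_mul_A (by norm_num)]
  have hpi : (Real.pi : ℂ) ≠ 0 := Complex.ofReal_ne_zero.mpr Real.pi_ne_zero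
  intro h
  push_cast at h
  field_simp at h
  norm_num at h

theorem invariantStates_actionJZ_subset :
    invariantStates actionJZ ⊆ invariantStates actionShift := fun φ hφ => by
  refine ⟨hφ.1, fun n x => hφ.2 ⟨shiftHom n, ?_⟩ x⟩
  -- A shift is onto, so its range has empty, hence finite, complement.
  have h : (Set.range ((shiftHom n).1 : ℤ → ℤ))ᶜ = ∅ :=
    Set.compl_empty_iff.mpr (Set.range_eq_univ.mpr (add_right_surjective n.toAdd))
  exact (congrArg Set.Finite h).mpr Set.finite_empty

theorem longRangeState_notMem : longRangeState ∉ invariantStates actionJZ := fun h =>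
  longRangeState_skipOne (h.2 _ _)

end CARAlgebra

end

theorem mainTheorem7 :
    invariantStates CARAlgebra.actionJZ ⊂ invariantStates CARAlgebra.actionShift ∧
    ∃ C : ℝ, 0 < C ∧ ∃ ω ∈ invariantStates CARAlgebra.actionShift,
      (∀ m n : ℤ, n < m →
        ω (star (CARAlgebra.A m) * CARAlgebra.A n) =
          3 * (C : ℂ) * Complex.I / ((Real.pi : ℂ) ^ 2 * ((m : ℂ) - (n : ℂ)) ^ 2)) ∧
      ω ∉ invariantStates CARAlgebra.actionJZ ∧ ω ∉ invariantStates CARAlgebra.actionLZ := by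
  refine ⟨⟨CARAlgebra.invariantStates_actionJZ_subset, fun h =>
      CARAlgebra.longRangeState_notMem (h CARAlgebra.longRangeState_mem)⟩,
    1 / 2, by norm_num, CARAlgebra.longRangeState, CARAlgebra.longRangeState_mem,
    fun m n h => CARAlgebra.longRangeState_star_A_mul_A h, CARAlgebra.longRangeState_notMem,
    -- The action of `𝕁_ℤ` is the restriction of that of `𝕃_ℤ`, so a spreadable state would be
    -- `𝕁_ℤ`-invariant.
    fun h => CARAlgebra.longRangeState_notMem ⟨h.1, fun g x => h.2 g.1 x⟩⟩
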